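/- Let $k$ be a field and $G$ a finite group. The Hochschild cohomology $HH^*(kG)$ is computed by the normalized bar complex $\mathcal H^*$: here $\mathcal H^n$ consists of the maps $\varphi:G^n\to kG$ that vanish as soon as one argument is $1$ (equivalently, maps $(G\setminus\{1\})^n\to kG$), with $$\delta(\varphi)(g_1,\dots,g_{n+1})=g_1\varphi(g_2,\dots,g_{n+1})+\sum_{i=1}^{n}(-1)^i\varphi(g_1,\dots,g_ig_{i+1},\dots,g_{n+1})+(-1)^{n+1}\varphi(g_1,\dots,g_n)g_{n+1}.$$ For a group $H$, $H^*(H,k)$ is computed by the normalized inhomogeneous cochains $\psi:H^n\to k$ (vanishing as soon as one argument is $1$) with the usual differential for the trivial module $k$. Let $\langle\ ,\ \rangle$ be the bilinear form on $kG$ with $\langle g,h\rangle=1$ if $g=h^{-1}$ and $0$ otherwise ($g,h\in G$). For $n\ge 1$ the BV operator is induced by $\triangle:\mathcal H^n\to\mathcal H^{n-1}$, $$\triangle(\varphi)(g_1,\dots,g_{n-1})=\sum_{g_n\in G}\sum_{i=1}^{n}(-1)^{i(n-1)}\langle\varphi(g_i,\dots,g_{n-1},g_n,g_1,\dots,g_{i-1}),1\rangle\,g_n^{-1}.$$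 For $x\in G$ let $C_x$ be its conjugacy class, $C_G(x)$ its centralizer, and $\mathcal H_x^n\subseteq\mathcal H^n$ the space of those $\varphi$ with $\varphi(g_1,\dots,g_n)\in k[g_1\cdots g_nC_x]$ for all $g_1,\dots,g_n$. **Theorem.** The operator $\triangle$ induces a well-defined map $\triangle:HH^n(kG)\to HH^{n-1}(kG)$ for all $n\ge1$. If $X$ is a set of representatives of the conjugacy classes of $G$, then the inclusions $\mathcal H_x^*\subseteq\mathcal H^*$ induce an isomorphism $\bigoplus_{x\in X}H^n(\mathcal H_x^*)\cong HH^n(kG)$ for all $n\ge0$. For every $x\in G$: 1. $\triangle$ maps $\mathcal H_x^n$ into $\mathcal H_x^{n-1}$ and induces $\triangle_x:H^n(\mathcal H_x^*)\to H^{n-1}(\mathcal H_x^*)$, compatible with $\triangle$ on $HH^*(kG)$ ($n\ge1$). 2. For all $n\ge0$ the rule $[\varphi]\mapsto[\widehat\varphi_x]$, where $\widehat\varphi_x(h_1,\dots,h_n)$ is the coefficient of $x$ in $\varphi(h_1,\dots,h_n)h_n^{-1}\cdots h_1^{-1}$ for $h_1,\dots,h_n\in C_G(x)$, is a well-defined isomorphism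 $H^n(\mathcal H_x^*)\cong H^n(C_G(x),k)$. 3. For $n\ge1$, the map $\widehat\triangle_x:H^n(C_G(x),k)\to H^{n-1}(C_G(x),k)$ that corresponds to $\triangle_x$ under the isomorphisms in 2 is induced by the following map of cochains (which sends normalized cocycles to normalized cocycles): $$\widehat\triangle_x(\psi)(h_1,\dots,h_{n-1})=\sum_{i=1}^{n}(-1)^{i(n-1)}\psi(h_i,\dots,h_{n-1},\,h_{n-1}^{-1}\cdots h_1^{-1}x^{-1},\,h_1,\dots,h_{i-1}).$$ -/

import Mathlib

noncomputable section

namespace GroupAlgebraBV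

/-! ### Cohomology of a subcomplex of a sequence of linear maps -/

section Cohomology

variable {k : Type*} [Field k] {C : ℕ → Type*} [∀ n, AddCommGroup (C n)] [∀ n, Module k (C n)]
  {C' : ℕ → Type*} [∀ n, AddCommGroup (C' n)] [∀ n, Module k (C' n)]

/-- The degree `n` cocycles of the complex `(N n, d n)`, where `N n ≤ C n`. -/
def cocycles (d : ∀ n, C n →ₗ[k] C (n + 1)) (N : ∀ n, Submodule k (C n)) (n : ℕ) :
    Submodule k (C n) :=
  N n ⊓ LinearMap.ker (d n)

/-- The degree `n` coboundaries of the complex `(N n, d n)`, where `N n ≤ C n`. -/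
def coboundaries (d : ∀ n, C n →ₗ[k] C (n + 1)) (N : ∀ n, Submodule k (C n)) :
    ∀ n, Submodule k (C n)
  | 0 => ⊥
  | n + 1 => (N n).map (d n)

/-- The degree `n` cohomology of the complex `(N n, d n)`: cocycles modulo coboundaries. -/
abbrev Cohomology (d : ∀ n, C n →ₗ[k] C (n + 1)) (N : ∀ n, Submodule k (C n)) (n : ℕ) :=
  cocycles d N n ⧸ (coboundaries d N n).submoduleOf (cocycles d N n)

/-- The cohomology class of a cocycle. -/
def cls (d : ∀ n, C n →ₗ[k] C (n + 1)) (N : ∀ n, Submodule k (C n)) {n : ℕ}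
    (φ : C n) (hφ : φ ∈ cocycles d N n) : Cohomology d N n :=
  Submodule.Quotient.mk ⟨φ, hφ⟩

/-- `F` is the map on cohomology induced by the cochain map `T` (in fixed degrees `n`, `m`):
`T` sends cocycles to cocycles and `F [φ] = [T φ]`. As every class is represented by a cocycle,
there is at most one such `F`. -/
def Induces (d : ∀ n, C n →ₗ[k] C (n + 1)) (N : ∀ n, Submodule k (C n))
    (d' : ∀ n, C' n →ₗ[k] C' (n + 1)) (N' : ∀ n, Submodule k (C' n)) {n m : ℕ}
    (T : C n →ₗ[k] C' m) (F : Cohomology d N n →ₗ[k] Cohomology d' N' m) : Prop :=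
  ∀ (φ : C n) (hφ : φ ∈ cocycles d N n),
    ∃ h : T φ ∈ cocycles d' N' m, F (cls d N φ hφ) = cls d' N' (T φ) h

end Cohomology

/-! ### Normalized cochains -/

/-- The product `g₁ ⋯ gₙ`. -/
def tupleProd {G : Type*} [Group G] {n : ℕ} (g : Fin n → G) : G := (List.ofFn g).prod

/-- Normalized `n`-cochains on `G` with values in `M`: maps `Gⁿ → M` that vanish as soon as one
argument is `1`. These are the same as maps `(G ∖ {1})ⁿ → M`. -/
def normalized (k G M : Type*) [Field k] [Group G] [AddCommGroup M] [Module k M] (n : ℕ) :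
    Submodule k ((Fin n → G) → M) where
  carrier := {φ | ∀ g, (∃ i, g i = 1) → φ g = 0}
  add_mem' := fun ha hb g hg => by simp [ha g hg, hb g hg]
  zero_mem' := fun _ _ => rfl
  smul_mem' := fun c a ha g hg => by simp [ha g hg]

/-! ### Group cohomology with trivial coefficients -/

/-- The differential of the inhomogeneous cochain complex of `G` with coefficients in the trivial
module `k`. The `j`-th term multiplies the arguments in places `j` and `j + 1` (counted from `0`)
for `j < n`, and for `j = n` it drops the last argument. -/
def groupD (k G : Type*) [Field k] [Group G] (n : ℕ) :
    ((Fin n → G) → k) →ₗ[k] ((Fin (n + 1) → G) → k) where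
  toFun ψ g := ψ (fun i => g i.succ) +
    ∑ j : Fin (n + 1), (-1 : k) ^ ((j : ℕ) + 1) * ψ (Fin.contractNth j (· * ·) g)
  map_add' a b := by
    funext g
    simp only [Pi.add_apply, mul_add, Finset.sum_add_distrib]
    abel
  map_smul' c a := by
    funext g
    simp only [Pi.smul_apply, smul_eq_mul, RingHom.id_apply, mul_add, Finset.mul_sum]
    congr 1
    exact Finset.sum_congr rfl fun j _ => by ring

/-- `groupD` is the differential of Mathlib's complex of inhomogeneous cochains of the trivial
representation. -/
theorem groupD_eq.{u} {k G : Type u} [Field k] [Group G] (n : ℕ) :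
    groupD k G n = (inhomogeneousCochains.d (Rep.trivial k G k) n).hom := rfl

/-- `Hⁿ(G, k)`, computed by the normalized bar resolution. -/
abbrev GroupH (k G : Type*) [Field k] [Group G] (n : ℕ) :=
  Cohomology (groupD k G) (normalized k G k) n

/-! ### Hochschild cohomology of the group algebra -/

section Hochschild

variable (k G : Type*) [Field k] [Group G]

/-- The Hochschild differential of `kG` on maps `Gⁿ → kG`. -/
def hochD (n : ℕ) :
    ((Fin n → G) → MonoidAlgebra k G) →ₗ[k] ((Fin (n + 1) → G) → MonoidAlgebra k G) where
  toFun φ g := MonoidAlgebra.of k G (g 0) * φ (fun i => g i.succ) +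
    ∑ j : Fin n, (-1 : k) ^ ((j : ℕ) + 1) • φ (Fin.contractNth j.castSucc (· * ·) g) +
    (-1 : k) ^ (n + 1) • (φ (fun i => g i.castSucc) * MonoidAlgebra.of k G (g (Fin.last n)))
  map_add' a b := by
    funext g
    simp only [Pi.add_apply, mul_add, add_mul, smul_add, Finset.sum_add_distrib]
    abel
  map_smul' c a := by
    funext g
    simp only [Pi.smul_apply, RingHom.id_apply, smul_add, Finset.smul_sum, mul_smul_comm,
      smul_mul_assoc, smul_comm c]

/-- `HHⁿ(kG)`, computed by the normalized bar resolution. -/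
abbrev HH (n : ℕ) := Cohomology (hochD k G) (normalized k G (MonoidAlgebra k G)) n

variable {G}

/-- The summand `𝓗ₓⁿ` of the normalized Hochschild complex attached to the conjugacy class `C_x`:
the `φ` such that `φ(g₁, …, gₙ)` lies in the span of `g₁ ⋯ gₙ C_x`. -/
def classCochains (x : G) (n : ℕ) : Submodule k ((Fin n → G) → MonoidAlgebra k G) where
  carrier := {φ | φ ∈ normalized k G (MonoidAlgebra k G) n ∧
    ∀ g y, (φ g).coeff y ≠ 0 → ∃ c, IsConj x c ∧ y = tupleProd g * c}
  add_mem' := fun {a b} ha hb => ⟨add_mem ha.1 hb.1, fun g y h => by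
    by_cases h' : (a g).coeff y = 0
    · exact hb.2 g y fun h'' => h (by simp [h', h''])
    · exact ha.2 g y h'⟩
  zero_mem' := ⟨zero_mem _, fun g y h => absurd (by simp) h⟩
  smul_mem' := fun c a ha => ⟨Submodule.smul_mem _ c ha.1, fun g y h =>
    ha.2 g y fun h' => h (by simp [h'])⟩

/-- `Hⁿ(𝓗ₓ*)`. -/
abbrev HHclass (x : G) (n : ℕ) := Cohomology (hochD k G) (classCochains k x) n

/-- The map `φ ↦ φ̂ₓ`, where `φ̂ₓ(h₁, …, hₙ)` is the coefficient of `x` in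
`φ(h₁, …, hₙ) hₙ⁻¹ ⋯ h₁⁻¹`, for `h₁, …, hₙ ∈ C_G(x)`. -/
def toCentralizer (x : G) (n : ℕ) : ((Fin n → G) → MonoidAlgebra k G) →ₗ[k]
    ((Fin n → Subgroup.centralizer ({x} : Set G)) → k) where
  toFun φ h := (φ (fun i => (h i : G)) *
    MonoidAlgebra.of k G (tupleProd fun i => (h i : G))⁻¹).coeff x
  map_add' a b := by
    funext h
    simp [add_mul]
  map_smul' c a := by
    funext h
    simp

end Hochschild

/-! ### The BV operator -/

/-- The arguments `(gᵢ, …, gₙ, g, g₁, …, gᵢ₋₁)` with `i = r + 1`: the cyclic rotation of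
`(g₁, …, gₙ, g)` that starts at place `r` (addition in `Fin (n + 1)` is modulo `n + 1`). -/
def rotated {G : Type*} {n : ℕ} (g : Fin n → G) (a : G) (r : Fin (n + 1)) : Fin (n + 1) → G :=
  fun j => Fin.snoc (α := fun _ => G) g a (j + r)

section BV

variable (k : Type*) [Field k] (G : Type*) [Group G] [Fintype G]

/-- The symmetrizing form of `kG`: the bilinear form with `⟨g, h⟩ = 1` if `g = h⁻¹` and
`⟨g, h⟩ = 0` otherwise, for `g, h ∈ G`. -/
def form : MonoidAlgebra k G →ₗ[k] MonoidAlgebra k G →ₗ[k] k :=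
  LinearMap.mk₂ k (fun a b => ∑ g : G, a.coeff g * b.coeff g⁻¹)
    (fun a a' b => by simp [add_mul, Finset.sum_add_distrib])
    (fun c a b => by simp [Finset.mul_sum, mul_assoc])
    (fun a b b' => by simp [mul_add, Finset.sum_add_distrib])
    (fun c a b => by simp [Finset.mul_sum, mul_left_comm])

open Classical in
theorem form_of_of (g h : G) :
    form k G (MonoidAlgebra.of k G g) (MonoidAlgebra.of k G h) = if g = h⁻¹ then 1 else 0 := by
  simp only [form, LinearMap.mk₂_apply, MonoidAlgebra.of_apply, MonoidAlgebra.coeff_single,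
    Finsupp.single_apply, ite_mul, one_mul, zero_mul, Finset.sum_ite_eq, Finset.mem_univ, if_true]
  exact if_congr ⟨fun e => by simp [e], fun e => by simp [e]⟩ rfl rfl

/-- The operator `Δ : Cⁿ⁺¹(kG) → Cⁿ(kG)`,
`Δ(φ)(g₁, …, gₙ) = ∑_g ∑ᵢ (-1)^{i n} ⟨φ(gᵢ, …, gₙ, g, g₁, …, gᵢ₋₁), 1⟩ g⁻¹`,
where `i = r + 1` runs over `1, …, n + 1`. -/
def bv (n : ℕ) :
    ((Fin (n + 1) → G) → MonoidAlgebra k G) →ₗ[k] ((Fin n → G) → MonoidAlgebra k G) where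
  toFun φ g := ∑ a : G,
    (∑ r : Fin (n + 1), (-1 : k) ^ (((r : ℕ) + 1) * n) * form k G (φ (rotated g a r)) 1) •
      MonoidAlgebra.of k G a⁻¹
  map_add' a b := by
    funext g
    simp only [Pi.add_apply, map_add, LinearMap.add_apply, mul_add, Finset.sum_add_distrib,
      add_smul]
  map_smul' c a := by
    funext g
    simp only [Pi.smul_apply, map_smul, LinearMap.smul_apply, smul_eq_mul, RingHom.id_apply,
      Finset.smul_sum, ← mul_smul, Finset.mul_sum, mul_left_comm]

/-- The equation that characterizes `Δ` through the symmetrizing form. -/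
theorem form_bv (n : ℕ) (φ : (Fin (n + 1) → G) → MonoidAlgebra k G) (g : Fin n → G) (a : G) :
    form k G (bv k G n φ g) (MonoidAlgebra.of k G a) =
      ∑ r : Fin (n + 1), (-1 : k) ^ (((r : ℕ) + 1) * n) * form k G (φ (rotated g a r)) 1 := by
  classical
  simp only [bv, LinearMap.coe_mk, AddHom.coe_mk, map_sum, map_smul, LinearMap.sum_apply,
    LinearMap.smul_apply, form_of_of, inv_inj, smul_eq_mul, mul_ite, mul_one, mul_zero,
    Finset.sum_ite_eq', Finset.mem_univ, if_true]

end BV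

/-- The operator `Δ̂ₓ` on cochains of `C_G(x)` with values in `k`:
`Δ̂ₓ(ψ)(h₁, …, hₙ) = ∑ᵢ (-1)^{i n} ψ(hᵢ, …, hₙ, hₙ⁻¹ ⋯ h₁⁻¹ x⁻¹, h₁, …, hᵢ₋₁)`,
where `i = r + 1` runs over `1, …, n + 1`. -/
def bvHat (k : Type*) [Field k] {G : Type*} [Group G] (x : G) (n : ℕ) :
    ((Fin (n + 1) → Subgroup.centralizer ({x} : Set G)) → k) →ₗ[k]
      ((Fin n → Subgroup.centralizer ({x} : Set G)) → k) where
  toFun ψ h := ∑ r : Fin (n + 1), (-1 : k) ^ (((r : ℕ) + 1) * n) *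
    ψ (rotated h
      ((tupleProd h)⁻¹ * ⟨x⁻¹, by rw [Subgroup.mem_centralizer_singleton_iff]; simp⟩) r)
  map_add' a b := by
    funext g
    simp only [Pi.add_apply, mul_add, Finset.sum_add_distrib]
  map_smul' c a := by
    funext g
    simp only [Pi.smul_apply, smul_eq_mul, RingHom.id_apply, Finset.mul_sum, mul_left_comm]

end GroupAlgebraBV

end

open GroupAlgebraBV

noncomputable section

namespace GroupAlgebraBV

/-! ### Maps induced on cohomology -/

section Cohomology

variable {k : Type*} [Field k] {C : ℕ → Type*} [∀ n, AddCommGroup (C n)] [∀ n, Module k (C n)]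
  {C' : ℕ → Type*} [∀ n, AddCommGroup (C' n)] [∀ n, Module k (C' n)]
  {d : ∀ n, C n →ₗ[k] C (n + 1)} {N : ∀ n, Submodule k (C n)}
  {d' : ∀ n, C' n →ₗ[k] C' (n + 1)} {N' : ∀ n, Submodule k (C' n)}

/-! The Hochschild complex splits by sending a coefficient `y` of `φ(g₁, …, gₙ)` to the class of
`(g₁ ⋯ gₙ)⁻¹ y`, which `δ` respects (`hochD_classProj`). For one class, replace `φ` by the function
on points `p₀, …, pₙ` of `G` whose value is the coefficient of `p₀⁻¹ x pₙ` in `φ(p₀⁻¹p₁, …,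
pₙ₋₁⁻¹pₙ)` (`homog`). This identifies `𝓗ₓ*` with the normalized `C_G(x)`-invariant simplicial
cochains on `G`, and `φ̂ₓ` with restriction to points of `C_G(x)`. A `C_G(x)`-equivariant retraction
`ρ : G → C_G(x)` extends cochains back, and the prism homotopy from the identity to `ρ` makes
restriction an isomorphism on cohomology (`exists_toCentralizer_eq`,
`mem_coboundaries_of_toCentralizer`).

For `Δ`, pair `φ` with one more argument (`pair`). Then `δ` becomes the sum over all cyclic faces,
and `Δ` becomes the signed norm over rotations applied to the coefficient of `1`. The cyclic
identity `sum_norm_cycFace`, together with the vanishing of the norm on rotation differences, gives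
`Δδ = -δΔ` (`bv_hochD`). The formula for `Δ̂ₓ` already holds for cochains (`toCentralizer_bv`): with
`g = (x h₁ ⋯ hₙ)⁻¹`, every rotation of `(h₁, …, hₙ, g)` has product `x⁻¹`. -/

/-- A linear map that preserves cocycles and coboundaries induces a map on cohomology. -/
theorem exists_induces {n m : ℕ} (T : C n →ₗ[k] C' m)
    (hz : ∀ φ ∈ cocycles d N n, T φ ∈ cocycles d' N' m)
    (hb : ∀ φ ∈ cocycles d N n, φ ∈ coboundaries d N n → T φ ∈ coboundaries d' N' m) :
    ∃ F : Cohomology d N n →ₗ[k] Cohomology d' N' m, Induces d N d' N' T F :=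
  ⟨Submodule.mapQ _ _ (T.restrict hz) fun φ hφ => hb φ φ.2 hφ, fun φ hφ => ⟨hz φ hφ, rfl⟩⟩

theorem cls_surjective {n : ℕ} (c : Cohomology d N n) :
    ∃ (φ : C n) (hφ : φ ∈ cocycles d N n), cls d N φ hφ = c := by
  obtain ⟨⟨φ, hφ⟩, rfl⟩ := Submodule.Quotient.mk_surjective _ c
  exact ⟨φ, hφ, rfl⟩

theorem cls_eq_zero_iff {n : ℕ} (φ : C n) (hφ : φ ∈ cocycles d N n) :
    cls d N φ hφ = 0 ↔ φ ∈ coboundaries d N n :=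
  Submodule.Quotient.mk_eq_zero _

theorem cls_sum {n : ℕ} {ι : Type*} (s : Finset ι) (φ : ι → C n)
    (hφ : ∀ i, φ i ∈ cocycles d N n) :
    ∑ i ∈ s, cls d N (φ i) (hφ i) = cls d N (∑ i ∈ s, φ i) (sum_mem fun i _ => hφ i) := by
  have : cls d N (∑ i ∈ s, φ i) (sum_mem fun i _ => hφ i) =
      Submodule.mkQ _ (∑ i ∈ s, (⟨φ i, hφ i⟩ : cocycles d N n)) := by
    rw [Submodule.mkQ_apply]
    exact congrArg _ (Subtype.ext (by simp))
  rw [this, map_sum]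
  rfl

end Cohomology

/-! ### Cochains on tuples of points -/

section Simplicial

variable {k : Type*} [Field k] {P : Type*}

/-- The simplicial differential: the alternating sum of `F` over the faces of a tuple. -/
def faceSum {n : ℕ} (F : (Fin n → P) → k) (p : Fin (n + 1) → P) : k :=
  ∑ i : Fin (n + 1), (-1 : k) ^ (i : ℕ) * F (p ∘ i.succAbove)

/-- `F` vanishes on tuples in which two consecutive entries agree. -/
def IsNormalized {n : ℕ} (F : (Fin n → P) → k) : Prop :=
  ∀ p, (∃ i j : Fin n, (i : ℕ) + 1 = j ∧ p i = p j) → F p = 0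

theorem cons_comp_succ_succAbove {n : ℕ} (a : P) (q : Fin (n + 1) → P) (i : Fin (n + 1)) :
    (Fin.cons a q : Fin (n + 2) → P) ∘ i.succ.succAbove = Fin.cons a (q ∘ i.succAbove) := by
  funext j
  refine Fin.cases ?_ (fun j => ?_) j <;> simp

/-- Only face `0` drops `a`; the others keep it and shift the sign. This recursion drives the prism
induction. -/
theorem faceSum_cons {n : ℕ} (F : (Fin (n + 1) → P) → k) (a : P) (q : Fin (n + 1) → P) :
    faceSum F (Fin.cons a q) = F q - faceSum (fun r => F (Fin.cons a r)) q := by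
  have h : (Fin.cons a q : Fin (n + 2) → P) ∘ (0 : Fin (n + 2)).succAbove = q := by
    funext j; simp
  simp only [faceSum, Fin.sum_univ_succ (n := n + 1), h, cons_comp_succ_succAbove, Fin.val_succ,
    pow_succ, Fin.val_zero, pow_zero, one_mul, mul_neg, mul_one, neg_mul, Finset.sum_neg_distrib,
    sub_eq_add_neg]

theorem faceSum_sub {n : ℕ} (F F' : (Fin n → P) → k) (p : Fin (n + 1) → P) :
    faceSum (fun q => F q - F' q) p = faceSum F p - faceSum F' p := by
  simp [faceSum, mul_sub]

theorem faceSum_comp {Q : Type*} (σ : P → Q) {n : ℕ} (F : (Fin n → Q) → k)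
    (p : Fin (n + 1) → P) : faceSum (fun q => F (σ ∘ q)) p = faceSum F (σ ∘ p) := rfl

/-- The prism operator of the homotopy between the identity and `ρ`. -/
def prism (ρ : P → P) : ∀ n : ℕ, ((Fin (n + 1) → P) → k) → (Fin n → P) → k
  | 0, _, _ => 0
  | n + 1, F, p => F (Fin.cons (p 0) (ρ ∘ p)) -
      prism ρ n (fun q => F (Fin.cons (p 0) q)) (Fin.tail p)

theorem prism_cons (ρ : P → P) {n : ℕ} (F : (Fin (n + 2) → P) → k) (a : P) (q : Fin n → P) :
    prism ρ (n + 1) F (Fin.cons a q) = F (Fin.cons a (Fin.cons (ρ a) (ρ ∘ q))) -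
      prism ρ n (fun r => F (Fin.cons a r)) q := by
  have h : ρ ∘ (Fin.cons a q : Fin (n + 1) → P) = Fin.cons (ρ a) (ρ ∘ q) := by
    funext j; refine Fin.cases ?_ (fun j => ?_) j <;> simp
  simp [prism, h]

theorem prism_sub (ρ : P → P) : ∀ {n : ℕ} (F F' : (Fin (n + 1) → P) → k) (p : Fin n → P),
    prism ρ n (fun q => F q - F' q) p = prism ρ n F p - prism ρ n F' p
  | 0, _, _, _ => by simp [prism]
  | n + 1, F, F', p => by
    simp only [prism]
    rw [prism_sub ρ (fun q => F (Fin.cons (p 0) q))]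
    ring

/-- The prism operator is a homotopy between the identity and composition with `ρ`. -/
theorem faceSum_prism (ρ : P → P) : ∀ {n : ℕ} (F : (Fin (n + 1) → P) → k) (p : Fin (n + 1) → P),
    faceSum (prism ρ n F) p + prism ρ (n + 1) (faceSum F) p = F (ρ ∘ p) - F p
  | 0, F, p => by
    obtain ⟨a, q, rfl⟩ : ∃ a q, p = Fin.cons a q := ⟨p 0, Fin.tail p, by simp⟩
    have h : ρ ∘ (Fin.cons a q : Fin 1 → P) = Fin.cons (ρ a) (ρ ∘ q) := by
      funext j; refine Fin.cases ?_ (fun j => ?_) j <;> simp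
    rw [prism_cons, faceSum_cons, h]
    simp [prism, faceSum, Subsingleton.elim (ρ ∘ q) q]
  | n + 1, F, p => by
    obtain ⟨a, q, rfl⟩ : ∃ a q, p = Fin.cons a q := ⟨p 0, Fin.tail p, by simp⟩
    have h : ρ ∘ (Fin.cons a q : Fin (n + 2) → P) = Fin.cons (ρ a) (ρ ∘ q) := by
      funext j; refine Fin.cases ?_ (fun j => ?_) j <;> simp
    have ih := faceSum_prism ρ (fun r => F (Fin.cons a r)) q
    have e1 : (fun r => faceSum F (Fin.cons a r)) =
        fun r => F r - faceSum (fun r => F (Fin.cons a r)) r :=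
      funext fun r => faceSum_cons F a r
    have e2 : (fun r => prism ρ (n + 1) F (Fin.cons a r)) =
        fun r => F (Fin.cons a (Fin.cons (ρ a) (ρ ∘ r))) -
          prism ρ n (fun r => F (Fin.cons a r)) r :=
      funext fun r => prism_cons ρ F a r
    rw [prism_cons, faceSum_cons, faceSum_cons, faceSum_cons, e1, prism_sub, e2, faceSum_sub,
      faceSum_comp ρ (fun r => F (Fin.cons a (Fin.cons (ρ a) r))), h]
    linear_combination ih

/-- Used with `σ` a left translation by the centralizer, to keep the homotopy equivariant. -/
theorem prism_comp (ρ σ : P → P) (h : ∀ p, σ (ρ p) = ρ (σ p)) :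
    ∀ {n : ℕ} (F : (Fin (n + 1) → P) → k) (p : Fin n → P),
    prism ρ n F (σ ∘ p) = prism ρ n (fun q => F (σ ∘ q)) p
  | 0, _, _ => rfl
  | n + 1, F, p => by
    have e (q : Fin (n + 1) → P) :
        (Fin.cons (σ (p 0)) (σ ∘ q) : Fin (n + 2) → P) = σ ∘ Fin.cons (p 0) q := by
      funext j; refine Fin.cases ?_ (fun j => ?_) j <;> simp
    have e' : ρ ∘ σ ∘ p = σ ∘ ρ ∘ p := by funext j; simp [h]
    have ih := prism_comp ρ σ h (fun q => F (Fin.cons (σ (p 0)) q)) (Fin.tail p)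
    simp only [prism, e] at ih ⊢
    rw [← ih, Function.comp_apply, e', e]
    rfl

/-- The terms are `F(p₀, …, pₗ, ρ pₗ, …, ρ pₙ)`; a consecutive repetition in `p` survives in the
first block or in its image under `ρ`. -/
theorem IsNormalized.prism {ρ : P → P} : ∀ {n : ℕ} {F : (Fin (n + 1) → P) → k},
    IsNormalized F → IsNormalized (prism ρ n F)
  | 0, _, _ => fun _ _ => rfl
  | n + 1, F, hF => by
    have hc (a : P) : IsNormalized fun q => F (Fin.cons a q) := by
      rintro q ⟨i, j, hij, hq⟩
      exact hF _ ⟨i.succ, j.succ, by simp [hij], by simpa using hq⟩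
    rintro p ⟨i, j, hij, hp⟩
    have h1 : F (Fin.cons (p 0) (ρ ∘ p)) = 0 :=
      hF _ ⟨i.succ, j.succ, by simp [hij], by simp [hp]⟩
    rw [GroupAlgebraBV.prism, h1, zero_sub, neg_eq_zero]
    obtain ⟨j, rfl⟩ := Fin.exists_succ_eq.2 (show j ≠ 0 by rintro rfl; simp at hij)
    refine Fin.cases (fun hij hp => ?_) (fun i hij hp => ?_) i hij hp
    · cases n with
      | zero => exact j.elim0
      | succ n =>
        have hj : j = 0 := by ext; simpa using hij.symm
        subst hj
        -- All remaining terms start with the repeated pair `p 0 = p 1`.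
        have h0 (r : Fin (n + 1) → P) : F (Fin.cons (p 0) (Fin.cons (p 1) r)) = 0 :=
          hF _ ⟨0, 1, rfl, by simpa using hp⟩
        rw [GroupAlgebraBV.prism]
        have ht : Fin.tail p 0 = p 1 := rfl
        simp only [ht, h0]
        have hz : ∀ m (r : Fin m → P), GroupAlgebraBV.prism ρ m (fun _ => (0 : k)) r = 0 := by
          intro m
          induction m with
          | zero => exact fun _ => rfl
          | succ m ih => intro r; simp [GroupAlgebraBV.prism, ih]
        rw [hz, sub_zero]
    · exact IsNormalized.prism (hc _) _ ⟨i, j, by simpa using hij, hp⟩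

end Simplicial

/-! ### Homogeneous cochains -/

section Homogeneous

variable {k G : Type*} [Field k] [Group G]

theorem coeff_of_mul (g y : G) (u : MonoidAlgebra k G) :
    (MonoidAlgebra.of k G g * u).coeff y = u.coeff (g⁻¹ * y) := by
  rw [MonoidAlgebra.of_apply, MonoidAlgebra.coeff_single_mul_eq_mul_coeff (g⁻¹ * y), one_mul]
  exact fun m _ => eq_inv_mul_iff_mul_eq.symm

theorem coeff_mul_of (g y : G) (u : MonoidAlgebra k G) :
    (u * MonoidAlgebra.of k G g).coeff y = u.coeff (y * g⁻¹) := by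
  rw [MonoidAlgebra.of_apply, MonoidAlgebra.coeff_mul_single_eq_coeff_mul (y * g⁻¹), mul_one]
  exact fun m _ => eq_mul_inv_iff_mul_eq.symm

theorem coeff_hochD {n : ℕ} (φ : (Fin n → G) → MonoidAlgebra k G) (g : Fin (n + 1) → G) (y : G) :
    (hochD k G n φ g).coeff y = (φ fun i => g i.succ).coeff ((g 0)⁻¹ * y) +
      ∑ j : Fin n, (-1 : k) ^ ((j : ℕ) + 1) *
        (φ (Fin.contractNth j.castSucc (· * ·) g)).coeff y +
      (-1 : k) ^ (n + 1) * (φ fun i => g i.castSucc).coeff (y * (g (Fin.last n))⁻¹) := by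
  simp only [hochD, LinearMap.coe_mk, AddHom.coe_mk, MonoidAlgebra.coeff_add,
    MonoidAlgebra.coeff_sum, MonoidAlgebra.coeff_smul, Finsupp.add_apply, Finsupp.smul_apply,
    Finsupp.finsetSum_apply, smul_eq_mul, coeff_of_mul, coeff_mul_of]

theorem tupleProd_succ {n : ℕ} (g : Fin (n + 1) → G) :
    tupleProd g = g 0 * tupleProd fun i => g i.succ := by
  simp [tupleProd]

theorem tupleProd_eq_partialProd {n : ℕ} (g : Fin n → G) :
    tupleProd g = Fin.partialProd g (Fin.last n) := by
  simp [tupleProd, Fin.partialProd, List.take_of_length_le]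

theorem tupleProd_castSucc {n : ℕ} (g : Fin (n + 1) → G) :
    tupleProd g = (tupleProd fun i => g i.castSucc) * g (Fin.last n) := by
  rw [tupleProd_eq_partialProd, tupleProd_eq_partialProd, ← Fin.succ_last, Fin.partialProd_succ,
    ← Fin.partialProd_init]
  rfl

theorem tupleProd_contractNth {n : ℕ} (g : Fin (n + 1) → G) (j : Fin n) :
    tupleProd (Fin.contractNth j.castSucc (· * ·) g) = tupleProd g := by
  rw [tupleProd_eq_partialProd, tupleProd_eq_partialProd, Fin.partialProd_contractNth,
    Function.comp_apply]
  congr 1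
  rw [Fin.succAbove_of_le_castSucc]
  · rfl
  · simp only [Fin.le_def, Fin.val_succ, Fin.val_castSucc, Fin.val_last]; omega

/-- The quotients of consecutive entries of a tuple of points. -/
def steps {n : ℕ} (p : Fin (n + 1) → G) (i : Fin n) : G := (p i.castSucc)⁻¹ * p i.succ

theorem smul_partialProd_steps {n : ℕ} (p : Fin (n + 1) → G) (i : Fin (n + 1)) :
    p 0 * Fin.partialProd (steps p) i = p i :=
  congrFun (Fin.partialProd_left_inv p) i

theorem steps_mul_partialProd {n : ℕ} (q : G) (g : Fin n → G) :
    steps (fun i => q * Fin.partialProd g i) = g := by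
  funext i
  simp [steps, ← Fin.partialProd_right_inv g i, mul_assoc]

theorem tupleProd_steps {n : ℕ} (p : Fin (n + 1) → G) :
    tupleProd (steps p) = (p 0)⁻¹ * p (Fin.last n) := by
  rw [tupleProd_eq_partialProd, eq_inv_mul_iff_mul_eq, smul_partialProd_steps]

/-- The two steps meeting at a deleted inner point multiply; deleting the last point drops the last
step, as `Fin.contractNth` does at its last index. -/
theorem steps_succAbove {n : ℕ} (p : Fin (n + 2) → G) (j : Fin (n + 1)) :
    steps (p ∘ j.succ.succAbove) = Fin.contractNth j (· * ·) (steps p) := by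
  have h : p ∘ j.succ.succAbove =
      fun i => p 0 * Fin.partialProd (Fin.contractNth j (· * ·) (steps p)) i := by
    funext i
    simp [Fin.partialProd_contractNth, smul_partialProd_steps]
  rw [h, steps_mul_partialProd]

theorem steps_comp_mul {n : ℕ} (c : G) (p : Fin (n + 1) → G) :
    steps (fun i => c * p i) = steps p := by
  funext i; simp [steps, mul_assoc]

/-- The homogeneous cochain attached to the part of `φ` at the conjugacy class of `x`. -/
def homog (x : G) {n : ℕ} (φ : (Fin n → G) → MonoidAlgebra k G) (p : Fin (n + 1) → G) : k :=
  (φ (steps p)).coeff ((p 0)⁻¹ * x * p (Fin.last n))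

/-- The outer multiplications in `δ` are absorbed by moving the end points in `p₀⁻¹ x pₙ`. -/
theorem homog_hochD (x : G) {n : ℕ} (φ : (Fin n → G) → MonoidAlgebra k G) :
    homog x (hochD k G n φ) = faceSum (homog x φ) := by
  funext p
  have hl : steps (p ∘ (Fin.last (n + 1)).succAbove) = fun i => steps p i.castSucc := by
    funext i; simp [steps]
  rw [homog, coeff_hochD, faceSum, Fin.sum_univ_succ, Fin.sum_univ_castSucc, ← add_assoc]
  congr 1
  · congr 1
    · simp only [homog, Fin.val_zero, pow_zero, one_mul, Function.comp_apply]
      congr 1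
      simp [steps, mul_assoc]
    · refine Finset.sum_congr rfl fun j _ => ?_
      simp only [homog, steps_succAbove, Fin.val_succ, Fin.val_castSucc, Function.comp_apply]
      congr 3
      · rw [Fin.succAbove_of_le_castSucc, Fin.succ_last]
        simp only [Fin.le_def, Fin.val_succ, Fin.val_castSucc, Fin.val_last]
        omega
  · simp only [homog, Fin.succ_last, hl, Fin.val_last, Function.comp_apply]
    congr 2
    simp [steps, mul_assoc]

theorem groupD_steps {n : ℕ} (ψ : (Fin n → G) → k) (p : Fin (n + 2) → G) :
    groupD k G n ψ (steps p) = faceSum (fun p => ψ (steps p)) p := by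
  rw [faceSum, Fin.sum_univ_succ]
  simp only [groupD, LinearMap.coe_mk, AddHom.coe_mk, steps_succAbove, Fin.val_zero, pow_zero,
    one_mul, Fin.val_succ]
  congr 1

theorem homog_mul (x : G) {n : ℕ} (φ : (Fin n → G) → MonoidAlgebra k G) (c : G)
    (hc : c ∈ Subgroup.centralizer ({x} : Set G)) (p : Fin (n + 1) → G) :
    homog x φ (fun i => c * p i) = homog x φ p := by
  rw [Subgroup.mem_centralizer_singleton_iff] at hc
  rw [homog, homog, steps_comp_mul]
  congr 1
  have : c⁻¹ * x * c = x := by rw [mul_assoc, ← hc]; group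
  calc _ = (p 0)⁻¹ * (c⁻¹ * x * c) * p (Fin.last n) := by group
    _ = _ := by rw [this]

theorem isNormalized_comp_steps {M : Type*} [AddCommGroup M] [Module k M] {n : ℕ}
    {φ : (Fin n → G) → M} (hφ : φ ∈ normalized k G M n) (p : Fin (n + 1) → G)
    (h : ∃ i j : Fin (n + 1), (i : ℕ) + 1 = j ∧ p i = p j) : φ (steps p) = 0 := by
  obtain ⟨i, j, hij, hp⟩ := h
  obtain ⟨j, rfl⟩ := Fin.exists_succ_eq.2 (show j ≠ 0 by rintro rfl; simp at hij)
  obtain rfl : i = j.castSucc := by ext; simpa using hij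
  exact hφ _ ⟨j, by simp [steps, hp]⟩

theorem isNormalized_homog (x : G) {n : ℕ} {φ : (Fin n → G) → MonoidAlgebra k G}
    (hφ : φ ∈ normalized k G (MonoidAlgebra k G) n) : IsNormalized (homog x φ) := fun p hp => by
  simp [homog, isNormalized_comp_steps hφ p hp]

/-- The supports of the values of `φ` lie in the translates of the conjugacy class of `x`. -/
def SupportedAt (x : G) {n : ℕ} (φ : (Fin n → G) → MonoidAlgebra k G) : Prop :=
  ∀ g y, (φ g).coeff y ≠ 0 → IsConj x ((tupleProd g)⁻¹ * y)

theorem mem_classCochains {x : G} {n : ℕ} {φ : (Fin n → G) → MonoidAlgebra k G} :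
    φ ∈ classCochains k x n ↔ φ ∈ normalized k G (MonoidAlgebra k G) n ∧ SupportedAt x φ := by
  refine and_congr_right fun _ => forall₂_congr fun g y => imp_congr_right fun _ => ⟨?_, fun h => ?_⟩
  · rintro ⟨c, hc, rfl⟩
    simpa using hc
  · exact ⟨_, h, by simp⟩

theorem SupportedAt.eq_of_homog_eq {x : G} {n : ℕ} {φ φ' : (Fin n → G) → MonoidAlgebra k G}
    (hφ : SupportedAt x φ) (hφ' : SupportedAt x φ') (h : homog x φ = homog x φ') : φ = φ' := by
  funext g
  ext y
  by_cases hy : IsConj x ((tupleProd g)⁻¹ * y)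
  · obtain ⟨c, hc⟩ := isConj_iff.1 hy
    -- This base point `p₀` is chosen so that `p₀⁻¹ x pₙ = y`.
    have := congrFun h fun i => (tupleProd g * c)⁻¹ * Fin.partialProd g i
    have e : ((tupleProd g * c)⁻¹ * 1)⁻¹ * x * ((tupleProd g * c)⁻¹ * tupleProd g) = y := by
      rw [← mul_right_inj (tupleProd g)⁻¹, ← hc]; group
    simpa only [homog, steps_mul_partialProd, Fin.partialProd_zero, ← tupleProd_eq_partialProd, e]
  · rw [not_not.1 (mt (hφ g y) hy), not_not.1 (mt (hφ' g y) hy)]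

/-- Writing `y = q⁻¹ x q g₁ ⋯ gₙ` determines `q` up to left multiplication by `C_G(x)`, so
invariance of `F` makes the chosen `q` harmless. -/
theorem exists_homog_eq [Finite G] (x : G) {n : ℕ} (F : (Fin (n + 1) → G) → k)
    (hF : IsNormalized F)
    (hc : ∀ c ∈ Subgroup.centralizer ({x} : Set G), ∀ p, F (fun i => c * p i) = F p) :
    ∃ φ ∈ classCochains k x n, homog x φ = F := by
  classical
  let φ : (Fin n → G) → MonoidAlgebra k G := fun g =>
    MonoidAlgebra.ofCoeff (Finsupp.equivFunOnFinite.symm fun y =>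
      if h : ∃ q, y * (tupleProd g)⁻¹ = q⁻¹ * x * q then
        F fun i => h.choose * Fin.partialProd g i else 0)
  have hφ (g y) : (φ g).coeff y = if h : ∃ q, y * (tupleProd g)⁻¹ = q⁻¹ * x * q then
        F fun i => h.choose * Fin.partialProd g i else 0 := rfl
  refine ⟨φ, mem_classCochains.2 ⟨?_, ?_⟩, ?_⟩
  · rintro g ⟨i, hi⟩
    ext y
    rw [hφ]
    split_ifs with h
    · exact hF _ ⟨i.castSucc, i.succ, rfl, by simp [Fin.partialProd_succ, hi]⟩
    · rfl
  · intro g y hy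
    rw [hφ] at hy
    split_ifs at hy with h
    · obtain ⟨q, hq⟩ := h
      refine isConj_iff.2 ⟨(tupleProd g)⁻¹ * q⁻¹, ?_⟩
      rw [← mul_left_inj (tupleProd g)⁻¹, mul_assoc _ y, hq]
      group
    · exact absurd rfl hy
  · funext p
    have h : ∃ q, (p 0)⁻¹ * x * p (Fin.last n) * (tupleProd (steps p))⁻¹ = q⁻¹ * x * q :=
      ⟨p 0, by rw [tupleProd_steps]; group⟩
    rw [homog, hφ, dif_pos h]
    have hq := h.choose_spec
    set q := h.choose
    -- The chosen `q` and `p 0` conjugate `x` to the same element.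
    have hm : q * (p 0)⁻¹ ∈ Subgroup.centralizer ({x} : Set G) := by
      rw [Subgroup.mem_centralizer_singleton_iff]
      have : (p 0)⁻¹ * x * p 0 = q⁻¹ * x * q := by rw [← hq, tupleProd_steps]; group
      calc q * (p 0)⁻¹ * x = q * ((p 0)⁻¹ * x * p 0) * (p 0)⁻¹ := by group
        _ = _ := by rw [this]; group
    rw [← hc _ hm p]
    congr 1
    funext i
    rw [← smul_partialProd_steps p i]
    group

end Homogeneous

/-! ### Decomposition along conjugacy classes -/

section ClassProj

variable {k G : Type*} [Field k] [Group G]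

open Classical in
/-- The projection of Hochschild cochains to the summand attached to the class of `x`. -/
def classProj (x : G) (n : ℕ) :
    ((Fin n → G) → MonoidAlgebra k G) →ₗ[k] ((Fin n → G) → MonoidAlgebra k G) where
  toFun φ g := .ofCoeff ((φ g).coeff.filter fun y => IsConj x ((tupleProd g)⁻¹ * y))
  map_add' a b := by
    funext g
    ext y
    simp [Finsupp.filter_apply]
  map_smul' c a := by
    funext g
    ext y
    simp [Finsupp.filter_apply]

open Classical in
theorem coeff_classProj (x : G) {n : ℕ} (φ : (Fin n → G) → MonoidAlgebra k G) (g : Fin n → G)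
    (y : G) : (classProj x n φ g).coeff y =
      if IsConj x ((tupleProd g)⁻¹ * y) then (φ g).coeff y else 0 :=
  Finsupp.filter_apply ..

theorem supportedAt_classProj (x : G) {n : ℕ} (φ : (Fin n → G) → MonoidAlgebra k G) :
    SupportedAt x (classProj x n φ) := by
  classical
  intro g y h
  rw [coeff_classProj] at h
  exact (ite_ne_right_iff.1 h).1

theorem SupportedAt.classProj_eq {x : G} {n : ℕ} {φ : (Fin n → G) → MonoidAlgebra k G}
    (h : SupportedAt x φ) : classProj x n φ = φ := by
  classical
  funext g
  ext y
  rw [coeff_classProj]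
  exact ite_eq_left_iff.2 fun hy => (not_not.1 (mt (h g y) hy)).symm

theorem SupportedAt.classProj_eq_zero {x x' : G} (hx : ¬ IsConj x' x) {n : ℕ}
    {φ : (Fin n → G) → MonoidAlgebra k G} (h : SupportedAt x φ) : classProj x' n φ = 0 := by
  classical
  funext g
  ext y
  rw [coeff_classProj]
  refine ite_eq_right_iff.2 fun hy => ?_
  by_contra h0
  exact hx (hy.trans (h g y h0).symm)

theorem classProj_mem {x : G} {n : ℕ} {φ : (Fin n → G) → MonoidAlgebra k G}
    (h : φ ∈ normalized k G (MonoidAlgebra k G) n) : classProj x n φ ∈ classCochains k x n := by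
  classical
  refine mem_classCochains.2 ⟨fun g hg => ?_, supportedAt_classProj x φ⟩
  ext y
  rw [coeff_classProj, h g hg]
  simp

/-- The first and inner terms of `δ` leave `(g₁ ⋯ gₙ₊₁)⁻¹ y` unchanged; the last conjugates it by
`gₙ₊₁`. -/
theorem hochD_classProj (x : G) {n : ℕ} (φ : (Fin n → G) → MonoidAlgebra k G) :
    hochD k G n (classProj x n φ) = classProj x (n + 1) (hochD k G n φ) := by
  classical
  funext g
  ext y
  have h0 : (tupleProd fun i => g i.succ)⁻¹ * ((g 0)⁻¹ * y) = (tupleProd g)⁻¹ * y := by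
    rw [tupleProd_succ]; group
  have h1 : IsConj x ((tupleProd fun i => g i.castSucc)⁻¹ * (y * (g (Fin.last n))⁻¹)) ↔
      IsConj x ((tupleProd g)⁻¹ * y) := by
    have : IsConj ((tupleProd g)⁻¹ * y)
        ((tupleProd fun i => g i.castSucc)⁻¹ * (y * (g (Fin.last n))⁻¹)) :=
      isConj_iff.2 ⟨g (Fin.last n), by rw [tupleProd_castSucc]; group⟩
    exact ⟨fun h => h.trans this.symm, fun h => h.trans this⟩
  simp only [coeff_hochD, coeff_classProj, h0, h1, tupleProd_contractNth]
  split_ifs <;> simp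

theorem SupportedAt.hochD {x : G} {n : ℕ} {φ : (Fin n → G) → MonoidAlgebra k G}
    (h : SupportedAt x φ) : SupportedAt x (hochD k G n φ) := by
  rw [← h.classProj_eq, hochD_classProj]
  exact supportedAt_classProj x _

theorem sum_classProj (X : Finset G) (hX : ∀ g, ∃! x, x ∈ X ∧ IsConj x g) {n : ℕ}
    (φ : (Fin n → G) → MonoidAlgebra k G) : ∑ x : X, classProj (x : G) n φ = φ := by
  classical
  funext g
  ext y
  obtain ⟨x, ⟨hx, hc⟩, hu⟩ := hX ((tupleProd g)⁻¹ * y)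
  rw [Finset.sum_apply, MonoidAlgebra.coeff_sum, Finsupp.finsetSum_apply,
    Finset.sum_eq_single (⟨x, hx⟩ : X), coeff_classProj, if_pos hc]
  · intro x' _ hx'
    rw [coeff_classProj, if_neg]
    exact fun h => hx' (Subtype.ext (hu _ ⟨x'.2, h⟩))
  · simp

theorem classCochains_le (x : G) (n : ℕ) :
    classCochains k x n ≤ normalized k G (MonoidAlgebra k G) n := fun _ h => h.1

theorem classCocycles_le (x : G) (n : ℕ) : cocycles (hochD k G) (classCochains k x) n ≤
    cocycles (hochD k G) (normalized k G (MonoidAlgebra k G)) n :=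
  inf_le_inf_right _ (classCochains_le x n)

theorem classCoboundaries_le (x : G) : ∀ n, coboundaries (hochD k G) (classCochains k x) n ≤
    coboundaries (hochD k G) (normalized k G (MonoidAlgebra k G)) n
  | 0 => le_rfl
  | n + 1 => Submodule.map_mono (classCochains_le x n)

theorem classProj_mem_cocycles {x : G} {n : ℕ} {φ : (Fin n → G) → MonoidAlgebra k G}
    (h : φ ∈ cocycles (hochD k G) (normalized k G (MonoidAlgebra k G)) n) :
    classProj x n φ ∈ cocycles (hochD k G) (classCochains k x) n := by
  refine ⟨classProj_mem h.1, ?_⟩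
  have h2 : hochD k G n φ = 0 := h.2
  rw [SetLike.mem_coe, LinearMap.mem_ker, hochD_classProj, h2, map_zero]

theorem classProj_mem_coboundaries {x : G} : ∀ {n : ℕ} {φ : (Fin n → G) → MonoidAlgebra k G},
    φ ∈ coboundaries (hochD k G) (normalized k G (MonoidAlgebra k G)) n →
    classProj x n φ ∈ coboundaries (hochD k G) (classCochains k x) n
  | 0, φ, h => by
    obtain rfl : φ = 0 := h
    rw [map_zero]
    exact zero_mem _
  | n + 1, _, ⟨ψ, hψ, e⟩ => ⟨classProj x n ψ, classProj_mem hψ, by rw [hochD_classProj, e]⟩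

/-- The inclusions of the summands induce a decomposition of Hochschild cohomology. -/
theorem bijective_sum_classCochains (X : Finset G) (hX : ∀ g, ∃! x, x ∈ X ∧ IsConj x g) (n : ℕ)
    (ι : ∀ x : G, HHclass k x n →ₗ[k] HH k G n)
    (hι : ∀ x, Induces (hochD k G) (classCochains k x)
        (hochD k G) (normalized k G (MonoidAlgebra k G)) LinearMap.id (ι x)) :
    Function.Bijective fun c : (∀ x : X, HHclass k (x : G) n) => ∑ x : X, ι x (c x) := by
  constructor
  · let S : (∀ x : X, HHclass k (x : G) n) →ₗ[k] HH k G n :=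
      ∑ x : X, ι x ∘ₗ LinearMap.proj x
    have hS (c) : S c = ∑ x : X, ι x (c x) := by simp [S]
    refine fun a b hab => ?_
    simp only [← hS] at hab
    rw [← sub_eq_zero] at hab ⊢
    rw [← map_sub, hS] at hab
    generalize a - b = c at hab
    choose φ hφ hc using fun x : X => cls_surjective (c x)
    have hi (x : X) : ι x (c x) = cls (hochD k G) _ (φ x) (classCocycles_le _ n (hφ x)) := by
      rw [← hc]
      exact (hι x _ (hφ x)).2
    simp only [hi] at hab
    rw [cls_sum, cls_eq_zero_iff] at hab
    funext x
    rw [← hc, Pi.zero_apply, cls_eq_zero_iff]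
    -- Projecting the bounding sum to the class of `x` leaves only the summand at `x`.
    have := classProj_mem_coboundaries (x := (x : G)) hab
    rw [map_sum, Finset.sum_eq_single x,
      (mem_classCochains.1 (hφ x).1).2.classProj_eq] at this
    · exact this
    · intro x' _ hx'
      refine (mem_classCochains.1 (hφ x').1).2.classProj_eq_zero fun h => hx' (Subtype.ext ?_)
      exact (hX x').unique ⟨x'.2, IsConj.refl _⟩ ⟨x.2, h⟩
    · simp
  · intro c
    obtain ⟨φ, hφ, rfl⟩ := cls_surjective c
    refine ⟨fun x => cls _ _ (classProj (x : G) n φ) (classProj_mem_cocycles hφ), ?_⟩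
    have hi (x : X) : ι x (cls _ _ (classProj (x : G) n φ) (classProj_mem_cocycles hφ)) =
        cls (hochD k G) _ (classProj (x : G) n φ)
          (classCocycles_le _ n (classProj_mem_cocycles hφ)) :=
      (hι x _ (classProj_mem_cocycles hφ)).2
    simp only [hi]
    rw [cls_sum]
    congr 1
    exact sum_classProj X hX φ

end ClassProj

/-! ### Restriction to the centralizer -/

section Centralizer

variable {k G : Type*} [Field k] [Group G]

/-- Take the `H`-factor in `G = H T`, for a transversal `T` containing `1`. -/
theorem exists_equivariant_retraction (H : Subgroup G) :
    ∃ ρ : G → H, (∀ (c : H) (p : G), ρ (c * p) = c * ρ p) ∧ ∀ c : H, ρ c = c := by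
  obtain ⟨T, hT, h1⟩ := H.exists_isComplement_right 1
  exact ⟨fun p => (hT.equiv p).1, fun c p => congrArg Prod.fst (hT.equiv_mul_left c p),
    fun c => hT.equiv_fst_eq_self_of_mem_of_one_mem h1 c.2⟩

theorem toCentralizer_apply (x : G) {n : ℕ} (φ : (Fin n → G) → MonoidAlgebra k G)
    (h : Fin n → Subgroup.centralizer ({x} : Set G)) :
    toCentralizer k x n φ h =
      (φ fun i => (h i : G)).coeff (x * tupleProd fun i => (h i : G)) := by
  simp only [toCentralizer, LinearMap.coe_mk, AddHom.coe_mk, coeff_mul_of, inv_inv]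

/-- Holds because `p₀⁻¹` commutes with `x`. -/
theorem toCentralizer_steps (x : G) {n : ℕ} (φ : (Fin n → G) → MonoidAlgebra k G)
    (p : Fin (n + 1) → Subgroup.centralizer ({x} : Set G)) :
    toCentralizer k x n φ (steps p) = homog x φ fun i => (p i : G) := by
  rw [toCentralizer_apply, homog]
  have : (fun i => ((steps p i : Subgroup.centralizer ({x} : Set G)) : G)) =
      steps fun i => (p i : G) := rfl
  rw [this, tupleProd_steps]
  have h := Subgroup.mem_centralizer_singleton_iff.1 (inv_mem (p 0).2)
  rw [← mul_assoc, ← h]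

theorem steps_surjective {H : Type*} [Group H] {n : ℕ} (g : Fin n → H) :
    ∃ p : Fin (n + 1) → H, steps p = g :=
  ⟨_, steps_mul_partialProd 1 g⟩

theorem groupD_toCentralizer (x : G) {n : ℕ} (φ : (Fin n → G) → MonoidAlgebra k G) :
    groupD k _ n (toCentralizer k x n φ) = toCentralizer k x (n + 1) (hochD k G n φ) := by
  funext h
  obtain ⟨p, rfl⟩ := steps_surjective h
  rw [groupD_steps, toCentralizer_steps, homog_hochD]
  simp only [toCentralizer_steps]
  rfl

theorem toCentralizer_mem_normalized (x : G) {n : ℕ} {φ : (Fin n → G) → MonoidAlgebra k G}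
    (hφ : φ ∈ normalized k G (MonoidAlgebra k G) n) :
    toCentralizer k x n φ ∈ normalized k (Subgroup.centralizer ({x} : Set G)) k n := by
  rintro h ⟨i, hi⟩
  rw [toCentralizer_apply, hφ _ ⟨i, by simp [hi]⟩]
  simp

theorem toCentralizer_mem_cocycles {x : G} {n : ℕ} {φ : (Fin n → G) → MonoidAlgebra k G}
    (hφ : φ ∈ cocycles (hochD k G) (classCochains k x) n) :
    toCentralizer k x n φ ∈ cocycles (groupD k (Subgroup.centralizer ({x} : Set G)))
      (normalized k (Subgroup.centralizer ({x} : Set G)) k) n := by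
  refine ⟨toCentralizer_mem_normalized x hφ.1.1, ?_⟩
  have h2 : hochD k G n φ = 0 := hφ.2
  rw [SetLike.mem_coe, LinearMap.mem_ker, groupD_toCentralizer, h2, map_zero]

theorem toCentralizer_mem_coboundaries {x : G} :
    ∀ {n : ℕ} {φ : (Fin n → G) → MonoidAlgebra k G},
    φ ∈ coboundaries (hochD k G) (classCochains k x) n →
    toCentralizer k x n φ ∈ coboundaries (groupD k (Subgroup.centralizer ({x} : Set G)))
      (normalized k (Subgroup.centralizer ({x} : Set G)) k) n
  | 0, φ, h => by
    obtain rfl : φ = 0 := h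
    rw [map_zero]
    exact zero_mem _
  | n + 1, _, ⟨ψ, hψ, e⟩ =>
    ⟨toCentralizer k x n ψ, toCentralizer_mem_normalized x hψ.1, by rw [groupD_toCentralizer, e]⟩

theorem isNormalized_retract {P H : Type*} [Group H] (ρ : P → H) {n : ℕ} {ψ : (Fin n → H) → k}
    (hψ : ψ ∈ normalized k H k n) : IsNormalized fun p : Fin (n + 1) → P => ψ (steps (ρ ∘ p)) := by
  rintro p ⟨i, j, hij, hp⟩
  exact isNormalized_comp_steps hψ _ ⟨i, j, hij, by simp [hp]⟩

theorem comp_retract_mul {H : Subgroup G} {ρ : G → H}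
    (hρ : ∀ (c : H) (p : G), ρ (c * p) = c * ρ p) {n : ℕ} (c : H) (p : Fin n → G) :
    (ρ ∘ fun i => (c : G) * p i) = fun i => c * (ρ ∘ p) i :=
  funext fun i => hρ c (p i)

/-- Every cocycle of the centralizer is the restriction of a Hochschild cocycle. -/
theorem exists_toCentralizer_eq [Finite G] {x : G} {n : ℕ}
    {ψ : (Fin n → Subgroup.centralizer ({x} : Set G)) → k}
    (hψ : ψ ∈ cocycles (groupD k (Subgroup.centralizer ({x} : Set G)))
      (normalized k (Subgroup.centralizer ({x} : Set G)) k) n) :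
    ∃ φ ∈ cocycles (hochD k G) (classCochains k x) n, toCentralizer k x n φ = ψ := by
  obtain ⟨ρ, hρ, hρ1⟩ := exists_equivariant_retraction (Subgroup.centralizer ({x} : Set G))
  -- Pulling `ψ` back along `ρ` gives an invariant cochain, restricting to `ψ` itself since `ρ`
  -- fixes the centralizer.
  obtain ⟨φ, hφ, e⟩ := exists_homog_eq x (fun p => ψ (steps (ρ ∘ p)))
    (isNormalized_retract ρ hψ.1) fun c hc p => by
      rw [comp_retract_mul hρ ⟨c, hc⟩, steps_comp_mul]
  refine ⟨φ, ⟨hφ, ?_⟩, ?_⟩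
  · refine (mem_classCochains.1 hφ).2.hochD.eq_of_homog_eq (φ' := 0)
      (fun g y h => absurd (by simp) h) ?_
    have h2 : groupD k _ n ψ = 0 := hψ.2
    funext p
    rw [homog_hochD, e, faceSum_comp ρ (fun p => ψ (steps p)), ← groupD_steps, h2]
    simp [homog]
  · funext h
    obtain ⟨p, rfl⟩ := steps_surjective h
    rw [toCentralizer_steps, e]
    have hp : (ρ ∘ fun i => (p i : G)) = p := funext fun i => hρ1 (p i)
    simp only [hp]

/-- A Hochschild cocycle whose restriction to the centralizer is a coboundary is a coboundary. -/
theorem mem_coboundaries_of_toCentralizer [Finite G] {x : G} {n : ℕ}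
    {φ : (Fin n → G) → MonoidAlgebra k G} (hφ : φ ∈ cocycles (hochD k G) (classCochains k x) n)
    (h : toCentralizer k x n φ ∈ coboundaries (groupD k (Subgroup.centralizer ({x} : Set G)))
      (normalized k (Subgroup.centralizer ({x} : Set G)) k) n) :
    φ ∈ coboundaries (hochD k G) (classCochains k x) n := by
  obtain ⟨ρ, hρ, -⟩ := exists_equivariant_retraction (Subgroup.centralizer ({x} : Set G))
  set σ : G → G := fun p => ρ p with hσ
  have h2 : hochD k G n φ = 0 := hφ.2
  have hd : faceSum (homog x φ) = fun _ => 0 := by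
    rw [← homog_hochD, h2]; funext p; simp [homog]
  have hz (m) (r : Fin m → G) : prism σ m (fun _ => (0 : k)) r = 0 := by
    simpa using prism_sub σ (fun _ => (0 : k)) (fun _ => 0) r
  -- For a cocycle, one of the two homotopy terms vanishes.
  have key (p) : faceSum (prism σ n (homog x φ)) p = homog x φ (σ ∘ p) - homog x φ p := by
    rw [← faceSum_prism, hd, hz, add_zero]
  have hr (p : Fin (n + 1) → G) : homog x φ (σ ∘ p) = toCentralizer k x n φ (steps (ρ ∘ p)) :=
    (toCentralizer_steps x φ (ρ ∘ p)).symm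
  have hs := (mem_classCochains.1 hφ.1).2
  cases n with
  | zero =>
    have h0 : toCentralizer k x 0 φ = 0 := h
    refine hs.eq_of_homog_eq (φ' := 0) (fun g y h => absurd (by simp) h) ?_
    funext p
    have := key p
    rw [hr, h0, Pi.zero_apply, zero_sub] at this
    rw [← neg_eq_iff_eq_neg.2 this]
    simp [faceSum, prism, homog]
  | succ n =>
    obtain ⟨ψ, hψ, e⟩ := h
    -- If `δψ` is the restriction, then `homog x φ` is the differential of `ψ ∘ ρ` minus the prism
    -- term.
    obtain ⟨φ', hφ', e'⟩ := exists_homog_eq x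
      (fun p => ψ (steps (ρ ∘ p)) - prism σ (n + 1) (homog x φ) p)
      (fun p hp => by
        simp only
        rw [show ψ (steps (ρ ∘ p)) = 0 from isNormalized_retract ρ hψ p hp, (isNormalized_homog x hφ.1.1).prism p hp, sub_zero])
      fun c hc p => by
        have := prism_comp σ (c * ·) (fun p => by simp [hσ, hρ ⟨c, hc⟩]) (homog x φ) p
        have hm : (fun q : Fin (n + 2) → G => homog x φ ((c * ·) ∘ q)) = homog x φ :=
          funext fun q => homog_mul x φ c hc q
        rw [hm] at this
        rw [comp_retract_mul hρ ⟨c, hc⟩, steps_comp_mul, ← this]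
        rfl
    refine ⟨φ', hφ', (mem_classCochains.1 hφ').2.hochD.eq_of_homog_eq hs ?_⟩
    funext p
    rw [homog_hochD, e', faceSum_sub, key, hr, faceSum_comp ρ (fun p => ψ (steps p)),
      ← groupD_steps, e, sub_sub_cancel]

end Centralizer

/-! ### Cyclic tuples -/

section Cyclic

variable {G : Type*}

/-- The cyclic rotation of a tuple by one place. -/
def cyc {n : ℕ} (c : Fin (n + 1) → G) : Fin (n + 1) → G := fun j => c (j + 1)

theorem cyc_iterate_apply {n : ℕ} (c : Fin (n + 1) → G) (r : ℕ) (j : Fin (n + 1)) :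
    cyc^[r] c j = c (j + Fin.ofNat (n + 1) r) := by
  induction r generalizing j with
  | zero => simp
  | succ r ih =>
    rw [Function.iterate_succ_apply', cyc, ih]
    congr 1
    ext
    simp [Fin.val_add, add_comm, add_left_comm]

theorem cyc_iterate_self {n : ℕ} (c : Fin (n + 1) → G) : cyc^[n + 1] c = c := by
  funext j
  rw [cyc_iterate_apply]
  congr 1
  ext
  simp

theorem rotated_eq {n : ℕ} (g : Fin n → G) (a : G) (r : Fin (n + 1)) :
    rotated g a r = cyc^[r] (Fin.snoc (α := fun _ => G) g a) := by
  funext j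
  rw [cyc_iterate_apply, rotated]
  congr 2
  ext
  simp

variable {k : Type*} [CommRing k]

/-- The norm: the signed sum over all rotations of a tuple. -/
def norm {n : ℕ} (f : (Fin (n + 1) → G) → k) (c : Fin (n + 1) → G) : k :=
  ∑ r ∈ Finset.range (n + 1), (-1 : k) ^ ((r + 1) * n) * f (cyc^[r] c)

theorem norm_sub {n : ℕ} (f f' : (Fin (n + 1) → G) → k) (c : Fin (n + 1) → G) :
    norm (fun c => f c - f' c) c = norm f c - norm f' c := by
  simp [norm, mul_sub]

/-- The sum telescopes around the full cycle, and `n (n + 1)` is even. -/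
theorem norm_cyc_sub {n : ℕ} (f : (Fin (n + 1) → G) → k) (c : Fin (n + 1) → G) :
    norm (fun c => f (cyc c) + (-1 : k) ^ (n + 1) * f c) c = 0 := by
  have h (r : ℕ) : (-1 : k) ^ ((r + 1) * n) *
      (f (cyc (cyc^[r] c)) + (-1 : k) ^ (n + 1) * f (cyc^[r] c)) =
      (-1 : k) ^ ((r + 1) * n) * f (cyc^[r + 1] c) - (-1 : k) ^ (r * n) * f (cyc^[r] c) := by
    rw [Function.iterate_succ_apply', mul_add, ← mul_assoc, ← pow_add,
      show (r + 1) * n + (n + 1) = r * n + (n + n) + 1 by ring, pow_succ, pow_add,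
      Even.neg_one_pow ⟨n, rfl⟩]
    ring
  simp only [norm, h]
  rw [Finset.sum_range_sub (fun r => (-1 : k) ^ (r * n) * f (cyc^[r] c)), cyc_iterate_self,
    mul_comm (n + 1), (Nat.even_mul_succ_self n).neg_one_pow]
  simp

variable [Mul G]

/-- The tuple obtained by multiplying the entries in places `j` and `j + 1`. For `j = n` the last
entry is dropped. -/
def contract {n : ℕ} (j : ℕ) (c : Fin (n + 1) → G) (i : Fin n) : G :=
  if (i : ℕ) < j then c i.castSucc else if (i : ℕ) = j then c i.castSucc * c i.succ else c i.succ

theorem castSucc_succ_add_one {n : ℕ} (i : Fin n) : i.castSucc.succ + 1 = i.succ.succ := by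
  rw [Fin.succ_castSucc, Fin.coeSucc_eq_succ]

theorem cyc_contract_succ {n j : ℕ} (hj : j < n) (c : Fin (n + 2) → G) :
    cyc (contract (j + 1) c) = contract j (cyc c) := by
  funext i
  refine Fin.lastCases ?_ (fun i => ?_) i
  · simp [cyc, contract, hj.not_gt, hj.ne']
  · simp [cyc, contract, castSucc_succ_add_one]

/-- Rotating past a merged entry costs two rotations of the original tuple. -/
theorem cyc_contract_zero {n : ℕ} (c : Fin (n + 2) → G) :
    cyc (contract 0 c) = contract n (cyc (cyc c)) := by
  funext i
  refine Fin.lastCases ?_ (fun i => ?_) i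
  · simp [cyc, contract]
  · simp [cyc, contract, castSucc_succ_add_one]

theorem cyc_iterate_contract_add {n : ℕ} (r j : ℕ) (h : j + r ≤ n) (c : Fin (n + 2) → G) :
    cyc^[r] (contract (j + r) c) = contract j (cyc^[r] c) := by
  induction r generalizing j with
  | zero => rfl
  | succ r ih =>
    rw [Function.iterate_succ_apply', Function.iterate_succ_apply', ← add_assoc, add_right_comm,
      ih (j + 1) (by omega), cyc_contract_succ (by omega)]

/-- The faces of a tuple `c` with entries in cyclic order. -/
def cycFace {n : ℕ} : ℕ → (Fin (n + 2) → G) → Fin (n + 1) → G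
  | 0, c => contract n (cyc c)
  | j + 1, c => contract j c

theorem cyc_iterate_cycFace_of_lt {n r j : ℕ} (h : r < j) (hj : j ≤ n + 1) (c : Fin (n + 2) → G) :
    cyc^[r] (cycFace j c) = contract (j - 1 - r) (cyc^[r] c) := by
  obtain ⟨i, rfl⟩ := Nat.exists_eq_add_of_lt h
  rw [cycFace, show r + i + 1 - 1 - r = i by omega, add_comm r i,
    cyc_iterate_contract_add _ _ (by omega)]

/-- Here the rotation starts after the first factor of the merged pair in cyclic order, hence the
extra `cyc`. -/
theorem cyc_iterate_cycFace_of_ge {n r j : ℕ} (h : j ≤ r) (hr : r ≤ n) (c : Fin (n + 2) → G) :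
    cyc^[r] (cycFace j c) = contract (n - r + j) (cyc^[r + 1] c) := by
  cases j with
  | zero =>
    have := cyc_iterate_contract_add r (n - r) (by omega) (cyc c)
    rw [Nat.sub_add_cancel hr] at this
    rw [cycFace, this, add_zero, Function.iterate_succ_apply]
  | succ j =>
    obtain ⟨s, rfl⟩ := Nat.exists_eq_add_of_le h
    have h1 := cyc_iterate_contract_add j 0 (by omega) c
    have h2 := cyc_iterate_contract_add s (n - s) (by omega) (cyc (cyc (cyc^[j] c)))
    rw [Nat.sub_add_cancel (by omega)] at h2
    rw [zero_add] at h1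
    rw [cycFace, show j + 1 + s = s + 1 + j by omega, Function.iterate_add_apply, h1,
      Function.iterate_succ_apply, cyc_contract_zero, h2,
      show n - (s + 1 + j) + (j + 1) = n - s by omega, show s + 1 + j + 1 = s + (1 + (1 + j)) by omega,
      Function.iterate_add_apply, Function.iterate_add_apply _ 1, Function.iterate_add_apply _ 1]
    rfl

/-- The norm exchanges the cyclic differential and its non-cyclic part. -/
theorem sum_norm_cycFace {n : ℕ} (f : (Fin (n + 1) → G) → k) (c : Fin (n + 2) → G) :
    ∑ j ∈ Finset.range (n + 2), (-1 : k) ^ j * norm f (cycFace j c) =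
      norm (fun c => ∑ j ∈ Finset.range (n + 1), (-1 : k) ^ j * f (contract j c)) c := by
  simp only [norm, Finset.mul_sum]
  rw [Finset.sum_comm, ← Finset.sum_product', ← Finset.sum_product']
  refine Finset.sum_nbij'
    -- Pairs (rotation, face) match pairs (rotation, contraction), by whether the rotation passes
    -- the merged pair.
    (fun p => if p.1 < p.2 then (p.1, p.2 - 1 - p.1) else (p.1 + 1, n - p.1 + p.2))
    (fun p => if p.1 + p.2 ≤ n then (p.1, p.1 + p.2 + 1) else (p.1 - 1, p.1 + p.2 - n - 1))
    ?_ ?_ ?_ ?_ ?_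
  · rintro ⟨r, j⟩ h
    simp only [Finset.mem_product, Finset.mem_range] at h ⊢
    split_ifs <;> simp only <;> omega
  · rintro ⟨r, j⟩ h
    simp only [Finset.mem_product, Finset.mem_range] at h ⊢
    split_ifs <;> simp only <;> omega
  · rintro ⟨r, j⟩ h
    simp only [Finset.mem_product, Finset.mem_range] at h ⊢
    split_ifs <;> ext <;> simp only at * <;> omega
  · rintro ⟨r, j⟩ h
    simp only [Finset.mem_product, Finset.mem_range] at h ⊢
    split_ifs <;> ext <;> simp only at * <;> omega
  · rintro ⟨r, j⟩ h
    simp only [Finset.mem_product, Finset.mem_range] at h ⊢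
    split_ifs with hrj
    · rw [cyc_iterate_cycFace_of_lt hrj (by omega), ← mul_assoc, ← mul_assoc, ← pow_add, ← pow_add]
      congr 1
      obtain ⟨i, rfl⟩ := Nat.exists_eq_add_of_lt hrj
      rw [neg_one_pow_congr]
      rw [show r + i + 1 - 1 - r = i by omega]
      simp only [parity_simps]
      tauto
    · rw [cyc_iterate_cycFace_of_ge (by omega) (by omega), ← mul_assoc, ← mul_assoc, ← pow_add,
        ← pow_add]
      congr 1
      obtain ⟨i, rfl⟩ := Nat.exists_eq_add_of_le (show r ≤ n by omega)
      rw [neg_one_pow_congr]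
      rw [show r + i - r = i by omega]
      simp only [parity_simps]
      tauto

end Cyclic

/-! ### The BV operator on cochains -/

section BV

variable {k G : Type*} [Field k] [Group G]

theorem form_one_right [Fintype G] (u : MonoidAlgebra k G) : form k G u 1 = u.coeff 1 := by
  classical
  simp [form, MonoidAlgebra.one_def, Finsupp.single_apply]

theorem coeff_bv [Fintype G] {n : ℕ} (φ : (Fin (n + 1) → G) → MonoidAlgebra k G) (g : Fin n → G)
    (a : G) : (bv k G n φ g).coeff a⁻¹ =
      ∑ r : Fin (n + 1), (-1 : k) ^ (((r : ℕ) + 1) * n) * (φ (rotated g a r)).coeff 1 := by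
  classical
  simp [bv, MonoidAlgebra.coeff_sum, Finsupp.finsetSum_apply, Finsupp.single_apply,
    form_one_right]

theorem tupleProd_cyc {n : ℕ} (c : Fin (n + 1) → G) :
    tupleProd (cyc c) = (c 0)⁻¹ * tupleProd c * c 0 := by
  rw [tupleProd_castSucc, tupleProd_succ c, inv_mul_cancel_left]
  simp [cyc]

theorem exists_tupleProd_cyc_iterate {n : ℕ} (c : Fin (n + 1) → G) (r : ℕ) :
    ∃ q, tupleProd (cyc^[r] c) = q⁻¹ * tupleProd c * q := by
  induction r with
  | zero => exact ⟨1, by simp⟩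
  | succ r ih =>
    obtain ⟨q, hq⟩ := ih
    refine ⟨q * cyc^[r] c 0, ?_⟩
    rw [Function.iterate_succ_apply', tupleProd_cyc, hq]
    group

/-- The value of the Hochschild cochain `φ`, paired with the last entry of the tuple. -/
def pair {n : ℕ} (φ : (Fin n → G) → MonoidAlgebra k G) (c : Fin (n + 1) → G) : k :=
  (φ fun i => c i.castSucc).coeff (c (Fin.last n))⁻¹

theorem pair_injective {n : ℕ} :
    Function.Injective (pair : ((Fin n → G) → MonoidAlgebra k G) → _) := by
  intro φ φ' h
  funext g
  ext y
  simpa [pair] using congrFun h (Fin.snoc g y⁻¹)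

theorem pair_bv [Fintype G] {n : ℕ} (φ : (Fin (n + 1) → G) → MonoidAlgebra k G) :
    pair (bv k G n φ) = norm fun c => (φ c).coeff 1 := by
  funext c
  have hc : (Fin.snoc (α := fun _ => G) (fun i => c i.castSucc) (c (Fin.last n))) = c :=
    Fin.snoc_init_self c
  rw [pair, coeff_bv, norm, Finset.sum_range]
  simp only [rotated_eq, hc]

theorem pair_hochD {n : ℕ} (φ : (Fin n → G) → MonoidAlgebra k G) (c : Fin (n + 2) → G) :
    pair (hochD k G n φ) c = ∑ j ∈ Finset.range (n + 2), (-1 : k) ^ j * pair φ (cycFace j c) := by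
  rw [pair, coeff_hochD, Finset.sum_range, Fin.sum_univ_succ, Fin.sum_univ_castSucc, ← add_assoc]
  congr 1
  · congr 1
    · simp [pair, cycFace, contract, cyc]
    · refine Finset.sum_congr rfl fun j _ => ?_
      have e : (fun i : Fin n => contract (j : ℕ) c i.castSucc) =
          Fin.contractNth j.castSucc (· * ·) fun i => c i.castSucc := rfl
      have e' : contract (j : ℕ) c (Fin.last n) = c (Fin.last (n + 1)) := by
        simp [contract, j.2.not_gt, j.2.ne']
      simp only [pair, cycFace, Fin.val_succ, Fin.val_castSucc, e, e']
  · have e : (fun i : Fin n => contract n c i.castSucc) = fun i => c i.castSucc.castSucc := by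
      funext i
      simp [contract]
    have e' : contract n c (Fin.last n) = c (Fin.last n).castSucc * c (Fin.last (n + 1)) := by
      simp [contract]
    simp [pair, cycFace, e, e']

/-- The outer terms of `δ` form the rotation difference killed by `norm`; the inner ones form the
non-cyclic part. -/
theorem coeff_hochD_one {n : ℕ} (φ : (Fin n → G) → MonoidAlgebra k G) (c : Fin (n + 1) → G) :
    (hochD k G n φ c).coeff 1 = (pair φ (cyc c) + (-1 : k) ^ (n + 1) * pair φ c) -
      ∑ j ∈ Finset.range n, (-1 : k) ^ j * (φ (contract j c)).coeff 1 := by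
  rw [coeff_hochD, Finset.sum_range]
  have e : (fun i : Fin n => cyc c i.castSucc) = fun i => c i.succ := by
    funext i
    simp [cyc]
  have e' : cyc c (Fin.last n) = c 0 := by simp [cyc]
  have e'' (j : Fin n) : Fin.contractNth j.castSucc (· * ·) c = contract j c := rfl
  simp only [pair, e, e', e'', mul_one, one_mul, pow_succ, mul_neg, neg_mul,
    Finset.sum_neg_distrib]
  ring

/-- The BV operator anticommutes with the Hochschild differential. -/
theorem bv_hochD [Fintype G] {n : ℕ} (φ : (Fin (n + 1) → G) → MonoidAlgebra k G) :
    bv k G (n + 1) (hochD k G (n + 1) φ) = - hochD k G n (bv k G n φ) := by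
  apply pair_injective
  funext c
  have hn : pair (-hochD k G n (bv k G n φ)) c = - pair (hochD k G n (bv k G n φ)) c := by
    simp [pair]
  rw [pair_bv, hn, pair_hochD, pair_bv, sum_norm_cycFace, ← zero_sub, ← norm_cyc_sub (pair φ) c,
    ← norm_sub]
  simp only [coeff_hochD_one]

theorem bv_hochD_zero [Fintype G] (φ : (Fin 0 → G) → MonoidAlgebra k G) :
    bv k G 0 (hochD k G 0 φ) = 0 := by
  apply pair_injective
  funext c
  rw [pair_bv]
  simp only [coeff_hochD_one, Finset.range_zero, Finset.sum_empty, sub_zero]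
  rw [norm_cyc_sub (pair φ)]
  simp [pair]

theorem bv_mem_normalized [Fintype G] {n : ℕ} {φ : (Fin (n + 1) → G) → MonoidAlgebra k G}
    (hφ : φ ∈ normalized k G (MonoidAlgebra k G) (n + 1)) :
    bv k G n φ ∈ normalized k G (MonoidAlgebra k G) n := by
  rintro g ⟨i, hi⟩
  ext y
  rw [← inv_inv y, coeff_bv]
  refine Finset.sum_eq_zero fun r _ => ?_
  -- The place of `g i` in the rotated tuple.
  rw [hφ _ ⟨i.castSucc - r, by simp [rotated, hi]⟩]
  simp

theorem exists_tupleProd_rotated {n : ℕ} (g : Fin n → G) (a : G) (r : Fin (n + 1)) :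
    ∃ q, tupleProd (rotated g a r) = q⁻¹ * (tupleProd g * a) * q := by
  rw [rotated_eq]
  have h : tupleProd (Fin.snoc (α := fun _ => G) g a) = tupleProd g * a := by
    simp [tupleProd_castSucc]
  rw [← h]
  exact exists_tupleProd_cyc_iterate _ _

theorem bv_mem_classCochains [Fintype G] {x : G} {n : ℕ}
    {φ : (Fin (n + 1) → G) → MonoidAlgebra k G} (hφ : φ ∈ classCochains k x (n + 1)) :
    bv k G n φ ∈ classCochains k x n := by
  refine mem_classCochains.2 ⟨bv_mem_normalized hφ.1, fun g y hy => ?_⟩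
  rw [← inv_inv y, coeff_bv] at hy
  obtain ⟨r, -, hr⟩ := Finset.exists_ne_zero_of_sum_ne_zero hy
  have h := (mem_classCochains.1 hφ).2 _ _ (right_ne_zero_of_mul hr)
  obtain ⟨q, hq⟩ := exists_tupleProd_rotated g y⁻¹ r
  rw [hq] at h
  exact h.trans (isConj_iff.2 ⟨(tupleProd g)⁻¹ * q, by group⟩)

theorem tupleProd_coe {H : Subgroup G} {n : ℕ} (h : Fin n → H) :
    (tupleProd fun i => (h i : G)) = (tupleProd h : H) := by
  rw [tupleProd, tupleProd, ← Subgroup.coe_subtype, map_list_prod, List.map_ofFn]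
  rfl

theorem coe_rotated {H : Subgroup G} {n : ℕ} (h : Fin n → H) (a : H) (r : Fin (n + 1)) :
    (fun i => ((rotated h a r i : H) : G)) = rotated (fun i => (h i : G)) (a : G) r := by
  funext i
  simp only [rotated]
  refine Fin.lastCases ?_ (fun j => ?_) (i + r) <;> simp

/-- Restriction to the centralizer intertwines the BV operator with its explicit counterpart. -/
theorem toCentralizer_bv [Fintype G] (x : G) {n : ℕ} (φ : (Fin (n + 1) → G) → MonoidAlgebra k G) :
    toCentralizer k x n (bv k G n φ) = bvHat k x n (toCentralizer k x (n + 1) φ) := by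
  funext h
  rw [toCentralizer_apply, ← inv_inv (x * _), coeff_bv]
  refine Finset.sum_congr rfl fun r _ => ?_
  rw [toCentralizer_apply, tupleProd_coe, tupleProd_coe, coe_rotated]
  -- Applied inside the centralizer, so `q` commutes with `x` and the rotated product is exactly
  -- `x⁻¹`.
  obtain ⟨q, hq⟩ := exists_tupleProd_rotated h
    ((tupleProd h)⁻¹ * ⟨x⁻¹, by rw [Subgroup.mem_centralizer_singleton_iff]; simp⟩) r
  have hx := Subgroup.mem_centralizer_singleton_iff.1 q.2
  rw [hq]
  congr 2
  · simp
  · have : (q : G)⁻¹ * x⁻¹ * q = x⁻¹ := by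
      rw [← mul_inv_rev, ← hx]; group
    simp [this]

end BV

/-! ### The induced operators and isomorphisms -/

section Induced

variable {k G : Type*} [Field k] [Group G] [Fintype G]

theorem bv_mem_cocycles {N : ∀ n, Submodule k ((Fin n → G) → MonoidAlgebra k G)}
    (hN : ∀ n, ∀ φ ∈ N (n + 1), bv k G n φ ∈ N n) {n : ℕ}
    {φ : (Fin (n + 1) → G) → MonoidAlgebra k G} (hφ : φ ∈ cocycles (hochD k G) N (n + 1)) :
    bv k G n φ ∈ cocycles (hochD k G) N n := by
  refine ⟨hN n φ hφ.1, ?_⟩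
  have h : hochD k G (n + 1) φ = 0 := hφ.2
  rw [SetLike.mem_coe, LinearMap.mem_ker, ← neg_eq_zero, ← bv_hochD, h, map_zero]

theorem bv_mem_coboundaries {N : ∀ n, Submodule k ((Fin n → G) → MonoidAlgebra k G)}
    (hN : ∀ n, ∀ φ ∈ N (n + 1), bv k G n φ ∈ N n) : ∀ {n : ℕ}
    {φ : (Fin (n + 1) → G) → MonoidAlgebra k G}, φ ∈ coboundaries (hochD k G) N (n + 1) →
    bv k G n φ ∈ coboundaries (hochD k G) N n
  | 0, _, ⟨ψ, _, e⟩ => by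
    -- Degree `0` has no nonzero coboundaries, so exact vanishing is needed.
    rw [← e, bv_hochD_zero]
    exact zero_mem _
  | n + 1, _, ⟨ψ, hψ, e⟩ => ⟨- bv k G n ψ, neg_mem (hN n ψ hψ), by rw [← e, bv_hochD, map_neg]⟩

theorem exists_induces_bv {N : ∀ n, Submodule k ((Fin n → G) → MonoidAlgebra k G)}
    (hN : ∀ n, ∀ φ ∈ N (n + 1), bv k G n φ ∈ N n) (n : ℕ) :
    ∃ D : Cohomology (hochD k G) N (n + 1) →ₗ[k] Cohomology (hochD k G) N n,
      Induces (hochD k G) N (hochD k G) N (bv k G n) D :=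
  exists_induces _ (fun _ => bv_mem_cocycles hN) fun _ _ => bv_mem_coboundaries hN

theorem exists_induces_inclusion {k G : Type*} [Field k] [Group G] (x : G) (n : ℕ) :
    ∃ ι : HHclass k x n →ₗ[k] HH k G n, Induces (hochD k G) (classCochains k x)
        (hochD k G) (normalized k G (MonoidAlgebra k G)) LinearMap.id ι :=
  exists_induces _ (fun _ h => classCocycles_le x n h) fun _ _ h => classCoboundaries_le x n h

/-- Restriction to the centralizer is an isomorphism on cohomology. -/
theorem exists_induces_toCentralizer (x : G) (n : ℕ) :
    ∃ e : HHclass k x n ≃ₗ[k] GroupH k (Subgroup.centralizer ({x} : Set G)) n,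
      Induces (hochD k G) (classCochains k x) (groupD k (Subgroup.centralizer ({x} : Set G)))
        (normalized k (Subgroup.centralizer ({x} : Set G)) k)
        (toCentralizer k x n) (e : HHclass k x n →ₗ[k] _) := by
  obtain ⟨F, hF⟩ := exists_induces (d := hochD k G) (N := classCochains k x)
    (d' := groupD k (Subgroup.centralizer ({x} : Set G)))
    (N' := normalized k (Subgroup.centralizer ({x} : Set G)) k) (toCentralizer k x n)
    (fun _ => toCentralizer_mem_cocycles) fun _ _ => toCentralizer_mem_coboundaries
  refine ⟨LinearEquiv.ofBijective F ⟨?_, ?_⟩, hF⟩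
  · refine (injective_iff_map_eq_zero F).2 fun c hc => ?_
    obtain ⟨φ, hφ, rfl⟩ := cls_surjective c
    obtain ⟨h, e⟩ := hF φ hφ
    rw [e, cls_eq_zero_iff] at hc
    rw [cls_eq_zero_iff]
    exact mem_coboundaries_of_toCentralizer hφ hc
  · intro c
    obtain ⟨ψ, hψ, rfl⟩ := cls_surjective c
    obtain ⟨φ, hφ, rfl⟩ := exists_toCentralizer_eq hψ
    exact ⟨cls _ _ φ hφ, (hF φ hφ).2⟩

end Induced

end GroupAlgebraBV

end

theorem mainTheorem4 (k : Type*) [Field k] (G : Type*) [Group G] [Fintype G] :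
    ∃ (D : ∀ n, HH k G (n + 1) →ₗ[k] HH k G n)
      (ι : ∀ (x : G) (n : ℕ), HHclass k x n →ₗ[k] HH k G n)
      (Dx : ∀ (x : G) (n : ℕ), HHclass k x (n + 1) →ₗ[k] HHclass k x n)
      (e : ∀ (x : G) (n : ℕ),
        HHclass k x n ≃ₗ[k] GroupH k (Subgroup.centralizer ({x} : Set G)) n),
      -- `D` is the operator induced by `Δ` on `HH*(kG)`
      (∀ n, Induces (hochD k G) (normalized k G (MonoidAlgebra k G))
        (hochD k G) (normalized k G (MonoidAlgebra k G)) (bv k G n) (D n)) ∧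
      -- `ι x` is induced by the inclusion of `𝓗ₓ*` into the Hochschild complex
      (∀ x n, Induces (hochD k G) (classCochains k x)
        (hochD k G) (normalized k G (MonoidAlgebra k G)) LinearMap.id (ι x n)) ∧
      -- `HHⁿ(kG)` is the direct sum of the `Hⁿ(𝓗ₓ*)` over representatives of the classes
      (∀ X : Finset G, (∀ g, ∃! x, x ∈ X ∧ IsConj x g) → ∀ n,
        Function.Bijective fun c : (∀ x : X, HHclass k (x : G) n) => ∑ x : X, ι x n (c x)) ∧
      -- `Δ` restricts to each summand, on cochains and on cohomology
      (∀ (x : G) (n : ℕ), ∀ φ ∈ classCochains k x (n + 1), bv k G n φ ∈ classCochains k x n) ∧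
      (∀ x n, Induces (hochD k G) (classCochains k x)
        (hochD k G) (classCochains k x) (bv k G n) (Dx x n)) ∧
      (∀ x n c, D n (ι x (n + 1) c) = ι x n (Dx x n c)) ∧
      -- `e x` is the isomorphism `Hⁿ(𝓗ₓ*) ≃ Hⁿ(C_G(x), k)`, `[φ] ↦ [φ̂ₓ]`
      (∀ (x : G) (n : ℕ), Induces (hochD k G) (classCochains k x)
        (groupD k (Subgroup.centralizer ({x} : Set G)))
        (normalized k (Subgroup.centralizer ({x} : Set G)) k)
        (toCentralizer k x n) (e x n : HHclass k x n →ₗ[k] _)) ∧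
      -- the operator on `H*(C_G(x), k)` induced via `e` is given by the formula for `Δ̂ₓ`
      (∀ (x : G) (n : ℕ), Induces (groupD k (Subgroup.centralizer ({x} : Set G)))
        (normalized k (Subgroup.centralizer ({x} : Set G)) k)
        (groupD k (Subgroup.centralizer ({x} : Set G)))
        (normalized k (Subgroup.centralizer ({x} : Set G)) k)
        (bvHat k x n)
        ((e x n : HHclass k x n →ₗ[k] _) ∘ₗ Dx x n ∘ₗ
          ((e x (n + 1)).symm : _ →ₗ[k] HHclass k x (n + 1)))) := by
  choose D hD using exists_induces_bv (k := k) (G := G) fun _ _ => bv_mem_normalized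
  choose ι hι using exists_induces_inclusion (k := k) (G := G)
  choose Dx hDx using fun x : G =>
    exists_induces_bv (k := k) (N := classCochains k x) fun _ _ => bv_mem_classCochains
  choose e he using exists_induces_toCentralizer (k := k) (G := G)
  refine ⟨D, ι, Dx, e, hD, hι, fun X hX n => bijective_sum_classCochains X hX n (ι · n) (hι · n),
    fun _ _ _ => bv_mem_classCochains, hDx, fun x n c => ?_, he, fun x n ψ hψ => ?_⟩
  · obtain ⟨φ, hφ, rfl⟩ := cls_surjective c
    obtain ⟨h1, e1⟩ := hι x (n + 1) φ hφ
    obtain ⟨h2, e2⟩ := hDx x n φ hφ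
    obtain ⟨_, e3⟩ := hD n φ h1
    obtain ⟨_, e4⟩ := hι x n _ h2
    rw [e1, e2, e4]
    exact e3
  -- An exact lift of the cocycle, not just of its class, turns `Δ̂ₓ ψ` into the restriction of `Δ
  -- φ`.
  · obtain ⟨φ, hφ, rfl⟩ := exists_toCentralizer_eq hψ
    obtain ⟨h1, e1⟩ := he x (n + 1) φ hφ
    obtain ⟨h2, e2⟩ := hDx x n φ hφ
    obtain ⟨h3, e3⟩ := he x n _ h2
    rw [LinearEquiv.coe_coe] at e1 e3
    rw [← toCentralizer_bv]
    refine ⟨h3, ?_⟩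
    rw [LinearMap.comp_apply, LinearMap.comp_apply, LinearEquiv.coe_coe, LinearEquiv.coe_coe, ← e1,
      LinearEquiv.symm_apply_apply, e2, e3]
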